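/- **Setting.** Let $\Omega$ be a measurable space with a $\sigma$-finite measure $\mu$ (for instance a finite set with counting measure, or a Euclidean rectangle with its Borel sets and Lebesgue measure). Let $\mathcal A^{k}$, $k\ge 0$, be nested dyadic partitions: $\mathcal A^{0}=\{\Omega\}$, and each $A\in\mathcal A^k$ is the disjoint union of a left child $A_l$ and a right child $A_r$ in $\mathcal A^{k+1}$ (possibly empty). Assume that the nodes, i.e. the sets in $\mathcal A^{(\infty)}=\bigcup_{k\ge 0}\mathcal A^k$, generate the $\sigma$-algebra. Write $A_p$ for the parent of a node $A\ne\Omega$. Let $I\ge 1$ be the number of shrinkage states. The hyperparameters are: initial probabilities $(\gamma_i(\Omega))_{i\le I}$; for each node $A\neq\Omega$ a stochastic matrix $(\gamma_{i,j}(A))_{i,j\le I}$; for each node $A$ (including $\Omega$) and each $i\le I$ a probability distribution $F^i_{\nu(A)}$ on $(0,\infty]$; and a probability measure $Q_0$ on $\Omega$. Put $\theta_0(A)=Q_0(A_l)/Q_0(A)$ (and $0$ if $Q_0(A)=0$). A random probability measure $Q$ has the distribution $\pi=\text{Markov-APT}(\gamma,F,Q_0)$ if almost surely $Q(A_l)=Q(A)\theta(A)$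 and $Q(A_r)=Q(A)(1-\theta(A))$ at every node $A$, where: * the states $C(A)\in\{1,\dots,I\}$ form a Markov tree: $P(C(\Omega)=i)=\gamma_i(\Omega)$, and given the states of its non-descendants, $C(A)=j$ with probability $\gamma_{C(A_p),j}(A)$ for $A\ne\Omega$; * given all the states, the $\nu(A)$ are independent with $\nu(A)\sim F^{C(A)}_{\nu(A)}$; * given all the states and all the $\nu(A)$, the $\theta(A)$ are independent with $\theta(A)\sim\mathrm{Beta}\big(\theta_0(A)\nu(A),(1-\theta_0(A))\nu(A)\big)$, read as the point mass at $\theta_0(A)$ when $\nu(A)=\infty$ or $\theta_0(A)\in\{0,1\}$. **Theorem (Large prior support).** Let $\pi=\text{Markov-APT}(\gamma,F,Q_0)$, and assume the absolute-continuity conditions: $\gamma_{i,j}(A)=0$ for $i>j$ and all nodes $A\neq\Omega$; $F^I_{\nu(A)}$ is the point mass at $\infty$ for every node $A$; and there is $\delta>0$ such that for all large enough $k$, $\gamma_{i,I}(A)>\delta$ for all $A\in\mathcal A^k$ and $i=1,\dots,I-1$. Assume moreover that 1. $Q_0\ll\mu$; 2. $I\ge 2$; 3. there is $\delta'>0$ such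 that for all large enough $k$, $\gamma_{i,I}(A)<1-\delta'$ for all $A\in\mathcal A^k$ and $i=1,\dots,I-1$; moreover, complete shrinkage is not forced at any coarser level: $\gamma_I(\Omega)<1$, and $\gamma_{i,I}(A)<1$ for all nodes $A\ne\Omega$ and $i=1,\dots,I-1$; 4. there are $\epsilon>0$ and $0<N<\infty$ such that $F^i_{\nu(A)}\big((0,N]\big)>\epsilon$ for all $i=1,\dots,I-1$ and all nodes $A$. Then for every probability measure $G\ll Q_0$ and every $\tau>0$, $$\pi\Big(\Big\{Q:\ Q\ll\mu,\ \int_\Omega |q-g|\,d\mu<\tau\Big\}\Big)>0,\qquad q=\frac{dQ}{d\mu},\quad g=\frac{dG}{d\mu}.$$ -/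

import Mathlib

open MeasureTheory ProbabilityTheory Filter
open scoped ENNReal NNReal

noncomputable section

/-- A sequence of nested dyadic partitions of the measurable space `Ω` whose sets generate the
σ-algebra. The nodes are labelled by binary words: the root `Ω` is the empty word, the left child
of `w` is `false :: w`, the right child is `true :: w`, and the partition at resolution `k` consists
of the sets of the words of length `k`. So the head of a word is the most recent split, and the
parent of a nonempty word is its tail. Partition sets may be empty. -/
structure PartitionTree (Ω : Type*) [mΩ : MeasurableSpace Ω] where
  node : List Bool → Set Ω
  node_nil : node [] = Set.univ
  node_split : ∀ w, node w = node (false :: w) ∪ node (true :: w)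
  node_disjoint : ∀ w, Disjoint (node (false :: w)) (node (true :: w))
  generates : mΩ = MeasurableSpace.generateFrom (Set.range node)

/-- The hyperparameters of a Markov adaptive Pólya tree with `K + 1` shrinkage states:
initial state probabilities, state transition probabilities (`trans w i j` is the probability
that the node `w` is in state `j` when its parent is in state `i`; it is used for `w ≠ []` only),
component priors on the precision at each node, supported on `(0, ∞]`, and the prior mean. -/
structure MarkovAPTParams (Ω : Type*) [MeasurableSpace Ω] (K : ℕ) where
  init : PMF (Fin (K + 1))
  trans : List Bool → Fin (K + 1) → PMF (Fin (K + 1))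
  comp : List Bool → Fin (K + 1) → ProbabilityMeasure ℝ≥0∞
  comp_zero : ∀ w i, (comp w i : Measure ℝ≥0∞) {0} = 0
  Q₀ : ProbabilityMeasure Ω

/-- The `Beta(m ν, (1 - m) ν)` distribution with mean `m ∈ [0, 1]` and precision `ν ∈ (0, ∞]`.
It is the point mass at `m` if `ν = ∞`, and also in the degenerate cases `m = 0` and `m = 1`. -/
def betaLaw (m : ℝ) (ν : ℝ≥0∞) : Measure ℝ :=
  if ν = ∞ ∨ m ≤ 0 ∨ 1 ≤ m then Measure.dirac m
  else betaMeasure (m * ν.toReal) ((1 - m) * ν.toReal)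

/-- `θ` is a collection of probability assignment coefficients of `Q`: at each node, the left child
receives the proportion `θ w` of the mass and the right child the proportion `1 - θ w`. -/
def HasPAC {Ω : Type*} [MeasurableSpace Ω] (T : PartitionTree Ω) (Q : Measure Ω)
    (θ : List Bool → ℝ) : Prop :=
  ∀ w, Q.real (T.node (false :: w)) = Q.real (T.node w) * θ w ∧
    Q.real (T.node (true :: w)) = Q.real (T.node w) * (1 - θ w)

namespace MarkovAPTParams

variable {Ω : Type*} [MeasurableSpace Ω] {K : ℕ}

/-- The coefficient `θ₀(A) = Q₀(A_l) / Q₀(A)` of the prior mean (zero if `Q₀(A) = 0`). -/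
def θ₀ (p : MarkovAPTParams Ω K) (T : PartitionTree Ω) (w : List Bool) : ℝ :=
  (p.Q₀ : Measure Ω).real (T.node (false :: w)) / (p.Q₀ : Measure Ω).real (T.node w)

/-- The factor of the node `w` in the probability of the state configuration `c` under the
Markov tree: initial probability at the root, transition probability from the parent elsewhere. -/
def stateFactor (p : MarkovAPTParams Ω K) (c : List Bool → Fin (K + 1)) : List Bool → ℝ≥0∞
  | [] => p.init (c [])
  | b :: w => p.trans (b :: w) (c w) (c (b :: w))

/-- `L` is the joint law of `(C(A), ν(A), θ(A))_A` under the hierarchical model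
`C ~ MT(γ)`, `ν(A) | C ~ F_A^{C(A)}`, `θ(A) | ν, C ~ Beta(θ₀(A) ν(A), (1 - θ₀(A)) ν(A))`
(independently over the nodes, in each of the last two steps). It is given through its
finite-dimensional distributions on all finite sets of nodes closed under taking the parent. -/
def IsHierarchicalLaw (p : MarkovAPTParams Ω K) (T : PartitionTree Ω)
    (L : Measure (List Bool → Fin (K + 1) × ℝ≥0∞ × ℝ)) : Prop :=
  ∀ S : Finset (List Bool), (∀ b w, b :: w ∈ S → w ∈ S) →
    ∀ (c : List Bool → Fin (K + 1)) (B : List Bool → Set ℝ≥0∞) (D : List Bool → Set ℝ),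
      (∀ w, MeasurableSet (B w)) → (∀ w, MeasurableSet (D w)) →
      L {x | ∀ w ∈ S, (x w).1 = c w ∧ (x w).2.1 ∈ B w ∧ (x w).2.2 ∈ D w} =
        ∏ w ∈ S, (p.stateFactor c w *
          ∫⁻ v in B w, betaLaw (p.θ₀ T w) v (D w) ∂(p.comp w (c w) : Measure ℝ≥0∞))

/-- `π` is the `Markov-APT(γ, F, Q₀)` distribution on probability measures: the law of a random
probability measure `Q` whose probability assignment coefficients are generated from the
hierarchical model. Here `J` is the joint law of `((C, ν, θ), Q)`. -/
def IsMarkovAPT (p : MarkovAPTParams Ω K) (T : PartitionTree Ω)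
    (π : Measure (ProbabilityMeasure Ω)) : Prop :=
  ∃ J : Measure ((List Bool → Fin (K + 1) × ℝ≥0∞ × ℝ) × ProbabilityMeasure Ω),
    p.IsHierarchicalLaw T (J.map Prod.fst) ∧
    (∀ᵐ z ∂J, HasPAC T (z.2 : Measure Ω) (fun w => (z.1 w).2.2)) ∧
    J.map Prod.snd = π

/-- All transition matrices are upper triangular. -/
def StochasticallyIncreasing (p : MarkovAPTParams Ω K) : Prop :=
  ∀ w ≠ [], ∀ i j : Fin (K + 1), j < i → p.trans w i j = 0

/-- The conditions for absolute continuity: the Markov-APT is stochastically increasing, the last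
state is complete shrinkage, and at all fine enough resolutions the transition probabilities into
it are bounded away from `0`. -/
def AbsContConditions (p : MarkovAPTParams Ω K) : Prop :=
  p.StochasticallyIncreasing ∧
  (∀ w, (p.comp w (Fin.last K) : Measure ℝ≥0∞) = Measure.dirac ∞) ∧
  ∃ δ : ℝ≥0∞, 0 < δ ∧ ∀ᶠ k : ℕ in atTop, ∀ w : List Bool, w.length = k →
    ∀ i : Fin (K + 1), i ≠ Fin.last K → δ < p.trans w i (Fin.last K)

end MarkovAPTParams

end

/-! Fix a level `k` at which the conditional expectation of dG/dQ₀ is within τ/2 of dG/dQ₀ in L¹(Q₀)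
(Lévy's upward theorem, `tendsto_integral_abs_levelDensity_sub`). Consider the event that above
level `k` every node avoids complete shrinkage, has precision at most `N` and a coefficient within η
of that of G, while from level `k` on every node is in complete shrinkage, so that its coefficient
is that of Q₀.

On this event Q is Q₀ reweighted by constants on the level-`k` nodes, so Q ≪ Q₀ ≪ μ. Its node masses
at level `k` differ from those of G by at most kη each, which bounds the L¹ distance
(`HasPAC.integral_abs_rnDeriv_sub_le`).

The event constrains infinitely many nodes, yet its probability is a finite product. Below level `k`
all factors are 1, because complete shrinkage is absorbing and forces θ = θ₀. The finitely many
other factors are positive: at level `k` by the lower bound δ, and above it because a Beta law of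
finite precision charges every interval in (0,1) (`setLIntegral_betaLaw_pos`,
`IsHierarchicalLaw.measure_pos`). -/

noncomputable section

/-- The finite set of binary words of length `k`. -/
def wordsOfLength (k : ℕ) : Finset (List Bool) := (List.finite_length_eq Bool k).toFinset

@[simp] lemma mem_wordsOfLength {k : ℕ} {w : List Bool} : w ∈ wordsOfLength k ↔ w.length = k := by
  simp [wordsOfLength]

/-- The finite set of binary words of length less than `n`. -/
def wordsShorterThan (n : ℕ) : Finset (List Bool) := (List.finite_length_lt Bool n).toFinset

@[simp] lemma mem_wordsShorterThan {n : ℕ} {w : List Bool} :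
    w ∈ wordsShorterThan n ↔ w.length < n := by
  simp [wordsShorterThan]

/-! ### Dyadic trees and piecewise constant densities. -/

namespace PartitionTree

variable {Ω : Type*} [mΩ : MeasurableSpace Ω] (T : PartitionTree Ω)

lemma measurableSet_node (w : List Bool) : MeasurableSet (T.node w) := by
  have h : MeasurableSet[MeasurableSpace.generateFrom (Set.range T.node)] (T.node w) :=
    MeasurableSpace.measurableSet_generateFrom ⟨w, rfl⟩
  rwa [← T.generates] at h

lemma node_cons_subset (b : Bool) (w : List Bool) : T.node (b :: w) ⊆ T.node w := by
  rw [T.node_split w]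
  cases b
  · exact Set.subset_union_left
  · exact Set.subset_union_right

lemma node_append_subset (u w : List Bool) : T.node (u ++ w) ⊆ T.node w := by
  induction u with
  | nil => exact subset_rfl
  | cons b u ih => exact (T.node_cons_subset b _).trans ih

lemma disjoint_node_cons (w : List Bool) {b c : Bool} (h : b ≠ c) :
    Disjoint (T.node (b :: w)) (T.node (c :: w)) := by
  cases b <;> cases c <;> simp_all [T.node_disjoint w, (T.node_disjoint w).symm]

lemma disjoint_node_of_length_eq : ∀ {v w : List Bool}, v.length = w.length → v ≠ w →
    Disjoint (T.node v) (T.node w)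
  | [], [], _, h => absurd rfl h
  | b :: v, c :: w, hl, h => by
    by_cases hvw : v = w
    · subst hvw
      exact T.disjoint_node_cons v fun hbc => h (by rw [hbc])
    · exact (disjoint_node_of_length_eq (by simpa using hl) hvw).mono
        (T.node_cons_subset b v) (T.node_cons_subset c w)

lemma node_subset_or_disjoint {v w : List Bool} (h : w.length ≤ v.length) :
    T.node v ⊆ T.node w ∨ Disjoint (T.node v) (T.node w) := by
  -- The head of a word is the latest split, so dropping from the front gives the ancestor of `v` at
  -- the level of `w`.
  have hv : v = v.take (v.length - w.length) ++ v.drop (v.length - w.length) := by simp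
  by_cases hd : v.drop (v.length - w.length) = w
  · left
    rw [hv, hd]
    exact T.node_append_subset _ _
  · right
    refine Disjoint.mono_left ?_ (T.disjoint_node_of_length_eq (by simp; omega) hd)
    conv_lhs => rw [hv]
    exact T.node_append_subset _ _

/-- Nodes are nested or disjoint. The level ranges over `ℕ∞` to cover both the filtration and, at
`⊤`, the whole tree. -/
lemma isPiSystem_image_node (k : ℕ∞) : IsPiSystem (T.node '' {w | (w.length : ℕ∞) ≤ k}) := by
  rintro _ ⟨v, hv, rfl⟩ _ ⟨w, hw, rfl⟩ hne
  rcases le_total w.length v.length with h | h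
  · rcases T.node_subset_or_disjoint h with h' | h'
    · exact ⟨v, hv, by rw [Set.inter_eq_left.2 h']⟩
    · exact absurd h'.inter_eq hne.ne_empty
  · rcases T.node_subset_or_disjoint h with h' | h'
    · exact ⟨w, hw, by rw [Set.inter_eq_right.2 h']⟩
    · exact absurd h'.symm.inter_eq hne.ne_empty

lemma ext_of_node {R R' : Measure Ω} [IsFiniteMeasure R] [IsFiniteMeasure R']
    (h : ∀ w, R.real (T.node w) = R'.real (T.node w)) : R = R' := by
  have h' : ∀ w, R (T.node w) = R' (T.node w) := fun w => (measureReal_eq_measureReal_iff).1 (h w)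
  refine ext_of_generate_finite (T.node '' {w | (w.length : ℕ∞) ≤ ⊤}) ?_
    (T.isPiSystem_image_node ⊤) ?_ ?_
  · simpa using T.generates
  · rintro _ ⟨w, -, rfl⟩
    exact h' w
  · simpa [T.node_nil] using h' []

lemma measureReal_node (R : Measure Ω) [IsFiniteMeasure R] (w : List Bool) :
    R.real (T.node w) = R.real (T.node (false :: w)) + R.real (T.node (true :: w)) := by
  conv_lhs => rw [T.node_split w]
  exact measureReal_union (T.node_disjoint w) (T.measurableSet_node _)

/-- The filtration generated by the nodes. -/
def filtration : Filtration ℕ mΩ where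
  seq k := MeasurableSpace.generateFrom (T.node '' {w | (w.length : ℕ∞) ≤ k})
  mono' _ _ h := MeasurableSpace.generateFrom_mono
    (Set.image_mono fun _ hw => le_trans (b := (_ : ℕ∞)) hw (by exact_mod_cast h))
  le' _ := MeasurableSpace.generateFrom_le (by rintro _ ⟨w, -, rfl⟩; exact T.measurableSet_node w)

lemma measurableSet_filtration_node {k : ℕ} {w : List Bool} (hw : w.length ≤ k) :
    MeasurableSet[T.filtration k] (T.node w) :=
  MeasurableSpace.measurableSet_generateFrom ⟨w, by simpa using hw, rfl⟩

lemma iSup_filtration : ⨆ k, T.filtration k = mΩ := by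
  refine le_antisymm (iSup_le T.filtration.le) ?_
  conv_lhs => rw [T.generates]
  refine MeasurableSpace.generateFrom_le ?_
  rintro _ ⟨w, rfl⟩
  exact le_iSup (fun k => (T.filtration k : MeasurableSpace Ω)) w.length _
    (T.measurableSet_filtration_node le_rfl)

/-- The density with respect to `P` of the measure that agrees with `R` on the nodes at level `k`
and is proportional to `P` inside each of them. -/
def levelDensity (P R : Measure Ω) (k : ℕ) (x : Ω) : ℝ :=
  ∑ w ∈ wordsOfLength k,
    (T.node w).indicator (fun _ => R.real (T.node w) / P.real (T.node w)) x

variable {T} {P R R' : Measure Ω} {k : ℕ}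

lemma levelDensity_nonneg (x : Ω) : 0 ≤ T.levelDensity P R k x :=
  Finset.sum_nonneg fun _ _ => Set.indicator_nonneg (fun _ _ => by positivity) _

lemma stronglyMeasurable_levelDensity :
    StronglyMeasurable[T.filtration k] (T.levelDensity P R k) := by
  unfold levelDensity
  refine Finset.stronglyMeasurable_fun_sum _ fun w hw => ?_
  exact stronglyMeasurable_const.indicator
    (T.measurableSet_filtration_node (mem_wordsOfLength.1 hw).le)

lemma measurable_levelDensity : Measurable (T.levelDensity P R k) :=
  (stronglyMeasurable_levelDensity.mono (T.filtration.le k)).measurable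

lemma integrable_levelDensity [IsFiniteMeasure P] : Integrable (T.levelDensity P R k) P :=
  integrable_finsetSum _ fun w _ => (integrable_const _).indicator (T.measurableSet_node w)

lemma levelDensity_eq {w : List Bool} (hw : w.length = k) {x : Ω} (hx : x ∈ T.node w) :
    T.levelDensity P R k x = R.real (T.node w) / P.real (T.node w) := by
  rw [levelDensity, Finset.sum_eq_single w]
  · exact Set.indicator_of_mem hx _
  · intro v hv hvw
    refine Set.indicator_of_notMem (fun hxv => ?_) _
    exact (T.disjoint_node_of_length_eq (by simp_all) hvw).le_bot ⟨hxv, hx⟩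
  · simp [hw]

lemma setIntegral_levelDensity_append (u : List Bool) {w : List Bool} (hw : w.length = k) :
    ∫ x in T.node (u ++ w), T.levelDensity P R k x ∂P =
      R.real (T.node w) / P.real (T.node w) * P.real (T.node (u ++ w)) := by
  rw [setIntegral_congr_fun (T.measurableSet_node _)
    (fun x hx => levelDensity_eq hw (T.node_append_subset u w hx)), setIntegral_const, smul_eq_mul,
    mul_comm]

/-- Additivity carries the identity from level `k` up to coarser nodes; `n` counts the levels still
to descend. At level `k`, `h0` handles null nodes, where the quotient is the default 0. -/
lemma setIntegral_levelDensity [IsFiniteMeasure P] [IsFiniteMeasure R]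
    (h0 : ∀ w : List Bool, w.length = k → P.real (T.node w) = 0 → R.real (T.node w) = 0) :
    ∀ (n : ℕ) (w : List Bool), w.length + n = k →
      ∫ x in T.node w, T.levelDensity P R k x ∂P = R.real (T.node w)
  | 0, w, hw => by
    have h := setIntegral_levelDensity_append (T := T) (P := P) (R := R) (k := k) [] hw
    simp only [List.nil_append] at h
    rw [h]
    by_cases hP : P.real (T.node w) = 0
    · rw [hP, h0 w hw hP, mul_zero]
    · rw [div_mul_cancel₀ _ hP]
  | n + 1, w, hw => by
    have h1 := setIntegral_levelDensity h0 n (false :: w) (by simp; omega)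
    have h2 := setIntegral_levelDensity h0 n (true :: w) (by simp; omega)
    rw [T.measureReal_node R w, ← h1, ← h2]
    conv_lhs => rw [T.node_split w]
    exact setIntegral_union (T.node_disjoint w) (T.measurableSet_node _)
      integrable_levelDensity.integrableOn integrable_levelDensity.integrableOn

lemma measureReal_withDensity_ofReal [IsFiniteMeasure P] {f : Ω → ℝ} (hf : Integrable f P)
    (hf0 : ∀ x, 0 ≤ f x) {s : Set Ω} (hs : MeasurableSet s) :
    (P.withDensity fun x => ENNReal.ofReal (f x)).real s = ∫ x in s, f x ∂P := by
  rw [measureReal_def, withDensity_apply _ hs,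
    ← ofReal_integral_eq_lintegral_ofReal hf.integrableOn (Eventually.of_forall hf0),
    ENNReal.toReal_ofReal (integral_nonneg hf0)]

lemma withDensity_levelDensity_eq [IsFiniteMeasure P] [IsFiniteMeasure R]
    (h0 : ∀ w : List Bool, w.length = k → P.real (T.node w) = 0 → R.real (T.node w) = 0)
    (h : ∀ u w : List Bool, w.length = k →
      R.real (T.node (u ++ w)) = R.real (T.node w) / P.real (T.node w) * P.real (T.node (u ++ w))) :
    P.withDensity (fun x => ENNReal.ofReal (T.levelDensity P R k x)) = R := by
  have := isFiniteMeasure_withDensity_ofReal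
    (integrable_levelDensity (T := T) (P := P) (R := R) (k := k)).2
  refine T.ext_of_node fun w => ?_
  rw [measureReal_withDensity_ofReal integrable_levelDensity levelDensity_nonneg
    (T.measurableSet_node w)]
  rcases le_total w.length k with hw | hw
  · exact setIntegral_levelDensity h0 (k - w.length) w (by omega)
  · have hv : w = w.take (w.length - k) ++ w.drop (w.length - k) := by simp
    have hl : (w.drop (w.length - k)).length = k := by simp; omega
    rw [hv, setIntegral_levelDensity_append _ hl, h _ _ hl]

lemma integral_abs_levelDensity_sub_le [IsFiniteMeasure P] :
    ∫ x, |T.levelDensity P R k x - T.levelDensity P R' k x| ∂P ≤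
      ∑ w ∈ wordsOfLength k, |R.real (T.node w) - R'.real (T.node w)| := by
  set c : List Bool → ℝ := fun w =>
    |R.real (T.node w) / P.real (T.node w) - R'.real (T.node w) / P.real (T.node w)| with hc
  have hint : ∀ w ∈ wordsOfLength k, Integrable ((T.node w).indicator fun _ => c w) P :=
    fun w _ => (integrable_const _).indicator (T.measurableSet_node w)
  calc ∫ x, |T.levelDensity P R k x - T.levelDensity P R' k x| ∂P
      ≤ ∫ x, ∑ w ∈ wordsOfLength k, (T.node w).indicator (fun _ => c w) x ∂P := by
        refine integral_mono (integrable_levelDensity.sub integrable_levelDensity).abs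
          (integrable_finsetSum _ hint) fun x => ?_
        simp only [levelDensity, ← Finset.sum_sub_distrib]
        refine (Finset.abs_sum_le_sum_abs _ _).trans (Finset.sum_le_sum fun w _ => ?_)
        by_cases hx : x ∈ T.node w <;> simp [hx, hc]
    _ = ∑ w ∈ wordsOfLength k, P.real (T.node w) * c w := by
        rw [integral_finsetSum _ hint]
        refine Finset.sum_congr rfl fun w _ => ?_
        rw [integral_indicator_const _ (T.measurableSet_node w), smul_eq_mul]
    _ ≤ _ := by
        refine Finset.sum_le_sum fun w _ => ?_
        by_cases hP : P.real (T.node w) = 0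
        · simp [hP]
        · simp only [hc]
          rw [← sub_div, abs_div, abs_of_nonneg (measureReal_nonneg (μ := P)),
            mul_div_cancel₀ _ hP]

/-- Integrals over nodes up to level `k` agree, and these nodes form a π-system generating the
`k`-th σ-algebra. -/
lemma levelDensity_ae_eq_condExp [IsFiniteMeasure P] [IsFiniteMeasure R] (hR : R ≪ P) :
    T.levelDensity P R k =ᵐ[P] P[fun x => (R.rnDeriv P x).toReal | T.filtration k] := by
  refine ae_eq_condExp_of_forall_setIntegral_eq (T.filtration.le k)
    Measure.integrable_toReal_rnDeriv (fun _ _ _ => integrable_levelDensity.integrableOn)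
    (fun s hs _ => ?_) stronglyMeasurable_levelDensity.aestronglyMeasurable
  have := isFiniteMeasure_withDensity_ofReal
    (integrable_levelDensity (T := T) (P := P) (R := R) (k := k)).2
  have hreal : ∀ w : List Bool, w.length ≤ k →
      (P.withDensity fun x => ENNReal.ofReal (T.levelDensity P R k x)) (T.node w) =
        R (T.node w) := by
    intro w hw
    rw [← measureReal_eq_measureReal_iff, measureReal_withDensity_ofReal integrable_levelDensity
      levelDensity_nonneg (T.measurableSet_node w)]
    refine setIntegral_levelDensity (fun v _ hv => ?_) (k - w.length) w (by omega)
    rw [measureReal_eq_zero_iff] at hv ⊢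
    exact hR hv
  have hs' := T.filtration.le k s hs
  rw [Measure.setIntegral_toReal_rnDeriv hR, ← measureReal_withDensity_ofReal
    integrable_levelDensity levelDensity_nonneg hs', measureReal_eq_measureReal_iff]
  refine ext_on_measurableSpace_of_generate_finite mΩ
    (T.node '' {w | (w.length : ℕ∞) ≤ k}) ?_ (T.filtration.le k) rfl (T.isPiSystem_image_node k)
    ?_ hs
  · rintro _ ⟨w, hw, rfl⟩
    exact hreal w (by simpa using hw)
  · simpa [T.node_nil] using hreal [] (by simp)

/-- Lévy's upward theorem for densities along the partition tree. -/
lemma tendsto_integral_abs_levelDensity_sub [IsFiniteMeasure P] [IsFiniteMeasure R]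
    (hR : R ≪ P) :
    Tendsto (fun k => ∫ x, |T.levelDensity P R k x - (R.rnDeriv P x).toReal| ∂P) atTop
      (nhds 0) := by
  have hg : Integrable (fun x => (R.rnDeriv P x).toReal) P := Measure.integrable_toReal_rnDeriv
  have h := hg.tendsto_eLpNorm_condExp (ℱ := T.filtration) (by
    rw [T.iSup_filtration]
    exact (Measure.measurable_rnDeriv R P).ennreal_toReal.stronglyMeasurable)
  have h' := (ENNReal.tendsto_toReal ENNReal.zero_ne_top).comp h
  simp only [ENNReal.toReal_zero] at h'
  refine h'.congr fun k => ?_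
  have hae := levelDensity_ae_eq_condExp (T := T) (k := k) hR
  simp only [Function.comp_apply]
  rw [eLpNorm_one_eq_lintegral_enorm, ← integral_norm_eq_lintegral_enorm
    (integrable_condExp.sub hg).aestronglyMeasurable]
  refine integral_congr_ae ?_
  filter_upwards [hae] with x hx
  simp [hx]

/-- The `L¹(μ)` distance of two densities equals the one computed relative to a dominating
measure `P ≪ μ`. -/
lemma integral_abs_rnDeriv_sub {μ : Measure Ω} [SigmaFinite μ] [IsFiniteMeasure P]
    [IsFiniteMeasure R] [IsFiniteMeasure R'] (hP : P ≪ μ) (hR : R ≪ P) (hR' : R' ≪ P) :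
    ∫ x, |(R.rnDeriv μ x).toReal - (R'.rnDeriv μ x).toReal| ∂μ =
      ∫ x, |(R.rnDeriv P x).toReal - (R'.rnDeriv P x).toReal| ∂P := by
  rw [← integral_rnDeriv_smul hP]
  refine integral_congr_ae ?_
  filter_upwards [Measure.rnDeriv_mul_rnDeriv (κ := μ) hR,
    Measure.rnDeriv_mul_rnDeriv (κ := μ) hR'] with x h1 h2
  rw [← h1, ← h2]
  simp only [Pi.mul_apply, ENNReal.toReal_mul, ← sub_mul, abs_mul, smul_eq_mul,
    abs_of_nonneg ENNReal.toReal_nonneg]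
  ring

end PartitionTree

end

/-! ### Positivity for Beta laws and their mixtures over the precision. -/

noncomputable section

lemma betaMeasure_pos_of_Ioo_subset {a b l u : ℝ} (ha : 0 < a) (hb : 0 < b) {D : Set ℝ}
    (hl : 0 ≤ l) (hu : u ≤ 1) (hlu : l < u) (hD : Set.Ioo l u ⊆ D) : 0 < betaMeasure a b D := by
  refine lt_of_lt_of_le ?_ (measure_mono hD)
  rw [betaMeasure, withDensity_apply _ measurableSet_Ioo,
    setLIntegral_pos_iff (f := betaPDF a b) (measurable_betaPDFReal a b).ennreal_ofReal,
    Set.inter_eq_right.2]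
  · simp [hlu]
  · intro x hx
    exact (ENNReal.ofReal_pos.2
      (betaPDFReal_pos (hl.trans_lt hx.1) (hx.2.trans_le hu) ha hb)).ne'

lemma continuousOn_beta :
    ContinuousOn (fun q : ℝ × ℝ => beta q.1 q.2) (Set.Ioi 0 ×ˢ Set.Ioi 0) := by
  have hG : ContinuousOn Real.Gamma (Set.Ioi 0) := fun x hx =>
    (Real.differentiableAt_Gamma fun m => by
      have : (0 : ℝ) < x := hx
      have : (0 : ℝ) ≤ m := m.cast_nonneg
      linarith).continuousAt.continuousWithinAt
  unfold beta
  refine ContinuousOn.div (.mul ?_ ?_) ?_ ?_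
  · exact hG.comp continuousOn_fst fun q hq => hq.1
  · exact hG.comp continuousOn_snd fun q hq => hq.2
  · exact hG.comp (by fun_prop) fun q hq => add_pos (Set.mem_Ioi.1 hq.1) (Set.mem_Ioi.1 hq.2)
  · exact fun q hq => (Real.Gamma_pos_of_pos (add_pos (Set.mem_Ioi.1 hq.1) hq.2)).ne'

/-- Separates the normalizing constant, continuous in the parameters, from an integral that is
measurable in them by Tonelli. -/
lemma betaMeasure_apply_eq {a b : ℝ} (ha : 0 < a) (hb : 0 < b) {D : Set ℝ}
    (hD : MeasurableSet D) :
    betaMeasure a b D = ENNReal.ofReal (1 / beta a b) *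
      ∫⁻ x in D ∩ Set.Ioo 0 1, ENNReal.ofReal (x ^ (a - 1) * (1 - x) ^ (b - 1)) := by
  rw [betaMeasure, withDensity_apply _ hD,
    ← lintegral_const_mul _ (Measurable.ennreal_ofReal (by fun_prop)),
    ← lintegral_indicator hD, ← lintegral_indicator (hD.inter measurableSet_Ioo)]
  refine lintegral_congr fun x => ?_
  by_cases hx : x ∈ D <;> by_cases hx' : 0 < x ∧ x < 1
  · rw [Set.indicator_of_mem hx, Set.indicator_of_mem (show x ∈ D ∩ Set.Ioo 0 1 from ⟨hx, hx'⟩),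
      betaPDF_eq, if_pos hx',
      ← ENNReal.ofReal_mul (one_div_nonneg.2 (beta_pos ha hb).le), mul_assoc]
  · rw [Set.indicator_of_mem hx, Set.indicator_of_notMem fun h => hx' h.2, betaPDF_eq, if_neg hx',
      ENNReal.ofReal_zero]
  · rw [Set.indicator_of_notMem hx, Set.indicator_of_notMem fun h => hx h.1]
  · rw [Set.indicator_of_notMem hx, Set.indicator_of_notMem fun h => hx h.1]

/-- Needed to pass from pointwise positivity to a positive integral. On (0, N] the precision is
finite and positive, so the Beta density formula applies throughout. -/
lemma aemeasurable_betaLaw {m : ℝ} (h0 : 0 < m) (h1 : m < 1) {D : Set ℝ} (hD : MeasurableSet D)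
    (N : ℝ≥0) (F : Measure ℝ≥0∞) :
    AEMeasurable (fun v => betaLaw m v D) (F.restrict (Set.Ioc 0 (N : ℝ≥0∞))) := by
  have hpos : ∀ v ∈ Set.Ioc 0 (N : ℝ≥0∞), 0 < v.toReal := fun v hv =>
    ENNReal.toReal_pos hv.1.ne' (hv.2.trans_lt ENNReal.coe_lt_top).ne
  have heq : ∀ v ∈ Set.Ioc 0 (N : ℝ≥0∞), betaLaw m v D =
      ENNReal.ofReal (1 / beta (m * v.toReal) ((1 - m) * v.toReal)) *
        ∫⁻ x in D ∩ Set.Ioo 0 1,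
          ENNReal.ofReal (x ^ (m * v.toReal - 1) * (1 - x) ^ ((1 - m) * v.toReal - 1)) := by
    intro v hv
    rw [betaLaw, if_neg, betaMeasure_apply_eq (mul_pos h0 (hpos v hv))
      (mul_pos (sub_pos.2 h1) (hpos v hv)) hD]
    have := (hv.2.trans_lt ENNReal.coe_lt_top).ne
    simp [this, h0, h1]
  refine AEMeasurable.congr (.mul ?_ ?_)
    ((ae_restrict_iff' measurableSet_Ioc).2 (Eventually.of_forall fun v hv => (heq v hv).symm))
  · refine AEMeasurable.ennreal_ofReal (ContinuousOn.aemeasurable ?_ measurableSet_Ioc)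
    have hc : ContinuousOn (fun v : ℝ≥0∞ => v.toReal) (Set.Ioc 0 (N : ℝ≥0∞)) := fun v hv =>
      (ENNReal.continuousAt_toReal
        (hv.2.trans_lt ENNReal.coe_lt_top).ne).continuousWithinAt
    refine continuousOn_const.div ?_ fun v hv =>
      (beta_pos (mul_pos h0 (hpos v hv)) (mul_pos (sub_pos.2 h1) (hpos v hv))).ne'
    exact continuousOn_beta.comp ((continuousOn_const.mul hc).prodMk (continuousOn_const.mul hc))
      fun v hv => ⟨mul_pos h0 (hpos v hv), mul_pos (sub_pos.2 h1) (hpos v hv)⟩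
  · refine Measurable.aemeasurable ?_
    refine Measurable.lintegral_prod_right' (f := fun q : ℝ≥0∞ × ℝ => ENNReal.ofReal
      (q.2 ^ (m * q.1.toReal - 1) * (1 - q.2) ^ ((1 - m) * q.1.toReal - 1))) ?_
    fun_prop

/-- An event that the Beta distribution of mean `m` charges for every finite positive precision
is charged by the mixture over the precisions as well. -/
lemma setLIntegral_betaLaw_pos {m : ℝ} {D : Set ℝ} (hD : MeasurableSet D) {N : ℝ≥0}
    {F : Measure ℝ≥0∞} (hF : F (Set.Ioc 0 (N : ℝ≥0∞)) ≠ 0)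
    (hDm : (m ≤ 0 ∨ 1 ≤ m) → m ∈ D)
    (hDI : 0 < m → m < 1 → ∃ l u, 0 ≤ l ∧ u ≤ 1 ∧ l < u ∧ Set.Ioo l u ⊆ D) :
    0 < ∫⁻ v in Set.Ioc 0 (N : ℝ≥0∞), betaLaw m v D ∂F := by
  by_cases hm : m ≤ 0 ∨ 1 ≤ m
  · have : ∀ v, betaLaw m v D = 1 := fun v => by
      rw [betaLaw, if_pos (Or.inr hm), Measure.dirac_apply' _ hD]
      simp [hDm hm]
    simp [this, pos_iff_ne_zero, hF]
  · push Not at hm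
    obtain ⟨l, u, hl, hu, hlu, hI⟩ := hDI hm.1 hm.2
    rw [pos_iff_ne_zero, ne_eq, lintegral_eq_zero_iff' (aemeasurable_betaLaw hm.1 hm.2 hD N F)]
    intro h
    rw [Filter.EventuallyEq, ae_restrict_iff' measurableSet_Ioc] at h
    refine hF (measure_mono_null (fun v hv => ?_) h)
    have hvt : v ≠ ∞ := (hv.2.trans_lt ENNReal.coe_lt_top).ne
    have hv0 : 0 < v.toReal := ENNReal.toReal_pos hv.1.ne' hvt
    have hpos := betaMeasure_pos_of_Ioo_subset (mul_pos hm.1 hv0)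
      (mul_pos (sub_pos.2 hm.2) hv0) hl hu hlu hI
    simp only [Set.mem_compl_iff, Set.mem_ofPred_eq, not_forall]
    refine ⟨hv, ?_⟩
    rw [betaLaw, if_neg (by simp [hvt, hm.1, hm.2])]
    exact hpos.ne'

end

/-! ### Positive probability for events on the whole tree. -/

noncomputable section

lemma PMF.exists_ne_apply_ne_zero {α : Type*} (q : PMF α) {a : α} (h : q a < 1) :
    ∃ i, i ≠ a ∧ q i ≠ 0 := by
  by_contra! hq
  refine h.ne ?_
  rw [← q.tsum_coe, tsum_eq_single a hq]

namespace MarkovAPTParams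

variable {Ω : Type*} [MeasurableSpace Ω] {K : ℕ} {p : MarkovAPTParams Ω K} {T : PartitionTree Ω}

/-- Triangularity leaves only the diagonal entry in the last row: complete shrinkage is absorbing.
-/
lemma StochasticallyIncreasing.trans_last_last (h : p.StochasticallyIncreasing) {w : List Bool}
    (hw : w ≠ []) : p.trans w (Fin.last K) (Fin.last K) = 1 := by
  rw [← (p.trans w (Fin.last K)).tsum_coe, tsum_eq_single (Fin.last K)]
  exact fun j hj => h w hw _ j (Fin.lt_last_iff_ne_last.2 hj)

/-- There is a configuration of states that stays out of complete shrinkage before level `k` with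
positive probability, and is in complete shrinkage from level `k` on. -/
lemma exists_states (hinit : p.init (Fin.last K) < 1)
    (hcoarse : ∀ w : List Bool, w ≠ [] →
      ∀ i : Fin (K + 1), i ≠ Fin.last K → p.trans w i (Fin.last K) < 1) (k : ℕ) :
    ∃ c : List Bool → Fin (K + 1),
      (∀ w, w.length < k → c w ≠ Fin.last K ∧ p.stateFactor c w ≠ 0) ∧
      ∀ w, k ≤ w.length → c w = Fin.last K := by
  obtain ⟨i₀, hi₀, hi₀'⟩ := p.init.exists_ne_apply_ne_zero hinit
  have hnext : ∀ (w : List Bool) (i : Fin (K + 1)), ∃ j,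
      w ≠ [] → i ≠ Fin.last K → j ≠ Fin.last K ∧ p.trans w i j ≠ 0 := by
    intro w i
    by_cases h : w ≠ [] ∧ i ≠ Fin.last K
    · obtain ⟨j, hj⟩ := (p.trans w i).exists_ne_apply_ne_zero (hcoarse w h.1 i h.2)
      exact ⟨j, fun _ _ => hj⟩
    · exact ⟨i, fun h1 h2 => absurd ⟨h1, h2⟩ h⟩
  choose next hnext using hnext
  let d : List Bool → Fin (K + 1) := fun w => w.rec i₀ fun b w i => next (b :: w) i
  have hd : ∀ w, d w ≠ Fin.last K := by
    intro w
    induction w with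
    | nil => exact hi₀
    | cons b w ih => exact (hnext (b :: w) (d w) (List.cons_ne_nil _ _) ih).1
  refine ⟨fun w => if w.length < k then d w else Fin.last K, fun w hw => ?_, fun w hw => ?_⟩
  · refine ⟨by simpa [hw] using hd w, ?_⟩
    cases w with
    | nil => simpa [stateFactor, show 0 < k from hw] using hi₀'
    | cons b w =>
      have hw' : w.length < k := (Nat.lt_succ_self _).trans hw
      simp only [stateFactor, hw, hw', if_true]
      exact (hnext (b :: w) (d w) (List.cons_ne_nil _ _) (hd w)).2
  · simp [hw.not_gt]

/-- Under the hierarchical law, an event that restricts all nodes has positive probability if every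
node has a positive factor and the factors are `1` at all fine resolutions. -/
lemma IsHierarchicalLaw.measure_pos {L : Measure (List Bool → Fin (K + 1) × ℝ≥0∞ × ℝ)}
    (hL : p.IsHierarchicalLaw T L) {c : List Bool → Fin (K + 1)} {B : List Bool → Set ℝ≥0∞}
    {D : List Bool → Set ℝ} (hB : ∀ w, MeasurableSet (B w)) (hD : ∀ w, MeasurableSet (D w))
    (h0 : ∀ w, p.stateFactor c w *
      ∫⁻ v in B w, betaLaw (p.θ₀ T w) v (D w) ∂(p.comp w (c w) : Measure ℝ≥0∞) ≠ 0)
    {n : ℕ} (h1 : ∀ w : List Bool, n ≤ w.length → p.stateFactor c w *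
      ∫⁻ v in B w, betaLaw (p.θ₀ T w) v (D w) ∂(p.comp w (c w) : Measure ℝ≥0∞) = 1) :
    0 < L {x | ∀ w, (x w).1 = c w ∧ (x w).2.1 ∈ B w ∧ (x w).2.2 ∈ D w} := by
  set factor := fun w => p.stateFactor c w *
    ∫⁻ v in B w, betaLaw (p.θ₀ T w) v (D w) ∂(p.comp w (c w) : Measure ℝ≥0∞) with hfactor
  set E : ℕ → Set (List Bool → Fin (K + 1) × ℝ≥0∞ × ℝ) := fun m =>
    {x | ∀ w ∈ wordsShorterThan m, (x w).1 = c w ∧ (x w).2.1 ∈ B w ∧ (x w).2.2 ∈ D w} with hE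
  have hLE : ∀ m, L (E m) = ∏ w ∈ wordsShorterThan m, factor w := fun m =>
    hL _ (fun b w h => by simp at h ⊢; omega) c B D hB hD
  have huniv : L Set.univ = 1 := by
    simpa using hL ∅ (by simp) c B D hB hD
  have hfin : IsFiniteMeasure L := ⟨by simp [huniv]⟩
  have hmeas : ∀ m, MeasurableSet (E m) := by
    intro m
    have : E m = ⋂ w ∈ wordsShorterThan m,
        (fun x : List Bool → Fin (K + 1) × ℝ≥0∞ × ℝ => x w) ⁻¹' ({c w} ×ˢ (B w ×ˢ D w)) := by
      ext x
      simp [hE, Set.mem_prod]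
    rw [this]
    exact Finset.measurableSet_biInter _ fun w _ => measurable_pi_apply w
      ((measurableSet_singleton _).prod ((hB w).prod (hD w)))
  have hanti : Antitone E := fun a b hab x hx w hw =>
    hx w (by simp at hw ⊢; omega)
  have hconst : ∀ m, n ≤ m → L (E m) = L (E n) := by
    intro m hm
    rw [hLE, hLE]
    symm
    refine Finset.prod_subset (fun w hw => by simp at hw ⊢; omega) fun w _ hw => h1 w ?_
    simpa using hw
  have hInter : {x | ∀ w, (x w).1 = c w ∧ (x w).2.1 ∈ B w ∧ (x w).2.2 ∈ D w} = ⋂ m, E m := by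
    ext x
    simp only [hE, Set.mem_ofPred_eq, Set.mem_iInter]
    exact ⟨fun h _ w _ => h w, fun h w => h (w.length + 1) w (by simp)⟩
  -- Continuity from above, along a sequence that is constant from `n` on.
  have hlim := tendsto_measure_iInter_atTop (μ := L) (fun m => (hmeas m).nullMeasurableSet) hanti
    ⟨0, measure_ne_top _ _⟩
  have hlim' : Tendsto (L ∘ E) atTop (nhds (L (E n))) :=
    tendsto_const_nhds.congr' ((eventually_ge_atTop n).mono fun m hm => (hconst m hm).symm)
  rw [hInter, tendsto_nhds_unique hlim hlim', hLE, pos_iff_ne_zero]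
  exact Finset.prod_ne_zero_iff.2 fun w _ => h0 w

end MarkovAPTParams

/-! ### Comparing measures through their coefficients. -/

namespace HasPAC

variable {Ω : Type*} [MeasurableSpace Ω] {T : PartitionTree Ω} {P Q G : Measure Ω}
  {m θ a : List Bool → ℝ} {k : ℕ} {η : ℝ}

lemma of_ratio (R : Measure Ω) [IsFiniteMeasure R] :
    HasPAC T R fun w => R.real (T.node (false :: w)) / R.real (T.node w) := by
  intro w
  by_cases h : R.real (T.node w) = 0
  · have h' := T.measureReal_node R w
    have h1 : 0 ≤ R.real (T.node (false :: w)) := measureReal_nonneg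
    have h2 : 0 ≤ R.real (T.node (true :: w)) := measureReal_nonneg
    constructor <;> rw [h, zero_mul] <;> linarith
  · rw [mul_one_sub, mul_div_cancel₀ _ h]
    exact ⟨rfl, by linarith [T.measureReal_node R w]⟩

/-- A null node with non-null parent comes from a degenerate coefficient of `P`, which `Q` shares.
-/
lemma measureReal_eq_zero [IsProbabilityMeasure P] (hP : HasPAC T P m) (hQ : HasPAC T Q θ)
    (h : ∀ w, w.length < k → (m w ≤ 0 ∨ 1 ≤ m w) → θ w = m w) :
    ∀ w : List Bool, w.length ≤ k → P.real (T.node w) = 0 → Q.real (T.node w) = 0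
  | [], _, h0 => by simp [T.node_nil] at h0
  | b :: w, hw, h0 => by
    have hw' : w.length < k := hw
    by_cases hPw : P.real (T.node w) = 0
    · have := measureReal_eq_zero hP hQ h w hw'.le hPw
      cases b
      · rw [(hQ w).1, this, zero_mul]
      · rw [(hQ w).2, this, zero_mul]
    · cases b
      · have hm : m w = 0 := by simpa [(hP w).1, hPw] using h0
        rw [(hQ w).1, h w hw' (Or.inl hm.le), hm, mul_zero]
      · have hm : 1 - m w = 0 := by simpa [(hP w).2, hPw] using h0
        rw [(hQ w).2, h w hw' (Or.inr (by linarith)), hm, mul_zero]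

/-- From level `k` on, both masses are multiplied by the same factors. -/
lemma measureReal_append (hP : HasPAC T P m) (hQ : HasPAC T Q θ)
    (h : ∀ w, k ≤ w.length → θ w = m w)
    (h0 : ∀ w : List Bool, w.length = k → P.real (T.node w) = 0 → Q.real (T.node w) = 0)
    (u : List Bool) {w : List Bool} (hw : w.length = k) :
    Q.real (T.node (u ++ w)) =
      Q.real (T.node w) / P.real (T.node w) * P.real (T.node (u ++ w)) := by
  induction u with
  | nil =>
    by_cases hPw : P.real (T.node w) = 0
    · simp [hPw, h0 w hw hPw]
    · simp [hPw]
  | cons b u ih =>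
    have hθ := h (u ++ w) (by simp; omega)
    cases b
    · rw [List.cons_append, (hQ _).1, (hP _).1, ih, hθ, mul_assoc]
    · rw [List.cons_append, (hQ _).2, (hP _).2, ih, hθ, mul_assoc]

/-- Each level adds at most η to the error, by Qs − Gt = Q(s − t) + (Q − G)t. -/
lemma abs_measureReal_sub_le [IsProbabilityMeasure Q] [IsProbabilityMeasure G]
    (hQ : HasPAC T Q θ) (hG : HasPAC T G a) (ha : ∀ w, 0 ≤ a w ∧ a w ≤ 1)
    (h : ∀ w, w.length < k → |θ w - a w| ≤ η) :
    ∀ w : List Bool, w.length ≤ k → |Q.real (T.node w) - G.real (T.node w)| ≤ w.length * η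
  | [], _ => by simp [T.node_nil]
  | b :: w, hw => by
    have ih := abs_measureReal_sub_le hQ hG ha h w (Nat.le_of_succ_le hw)
    have hη := h w hw
    have hQ1 : Q.real (T.node w) ≤ 1 := measureReal_le_one
    have hQ0 : 0 ≤ Q.real (T.node w) := measureReal_nonneg
    have key : ∀ s t : ℝ, |s - t| ≤ η → 0 ≤ t → t ≤ 1 →
        |Q.real (T.node w) * s - G.real (T.node w) * t| ≤ (w.length + 1) * η := by
      intro s t hst ht0 ht1
      calc |Q.real (T.node w) * s - G.real (T.node w) * t|
          = |Q.real (T.node w) * (s - t) + (Q.real (T.node w) - G.real (T.node w)) * t| := by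
            congr 1; ring
        _ ≤ Q.real (T.node w) * |s - t| + |Q.real (T.node w) - G.real (T.node w)| * t := by
            refine (abs_add_le _ _).trans_eq ?_
            rw [abs_mul, abs_mul, abs_of_nonneg hQ0, abs_of_nonneg ht0]
        _ ≤ 1 * η + w.length * η := by
            refine add_le_add (mul_le_mul hQ1 hst (abs_nonneg _) zero_le_one) ?_
            exact (mul_le_of_le_one_right (abs_nonneg _) ht1).trans ih
        _ = (w.length + 1) * η := by ring
    simp only [List.length_cons, Nat.cast_add, Nat.cast_one]
    cases b
    · rw [(hQ w).1, (hG w).1]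
      exact key _ _ hη (ha w).1 (ha w).2
    · rw [(hQ w).2, (hG w).2]
      refine key _ _ ?_ (sub_nonneg.2 (ha w).2) (sub_le_self _ (ha w).1)
      rwa [sub_sub_sub_cancel_left, abs_sub_comm]

/-- If `G ≪ P`, then `G` has coefficients in `[0, 1]` that agree with those of `P` wherever the
latter are degenerate. -/
lemma exists_coefficients [IsFiniteMeasure P] [IsFiniteMeasure G] (hP : HasPAC T P m)
    (hm : ∀ w, 0 ≤ m w ∧ m w ≤ 1) (hG : G ≪ P) :
    ∃ a : List Bool → ℝ, HasPAC T G a ∧ (∀ w, 0 ≤ a w ∧ a w ≤ 1) ∧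
      ∀ w, (m w ≤ 0 ∨ 1 ≤ m w) → a w = m w := by
  classical
  have hnull : ∀ w, P.real (T.node w) = 0 → G.real (T.node w) = 0 := fun w hw => by
    rw [measureReal_eq_zero_iff] at hw ⊢
    exact hG hw
  -- The ratio alone fails at a `G`-null node with `m w = 1`, where 0/0 = 0; there any coefficient
  -- is admissible, so that of `P` is used.
  refine ⟨fun w => if m w ≤ 0 ∨ 1 ≤ m w then m w else
    G.real (T.node (false :: w)) / G.real (T.node w), fun w => ?_, fun w => ?_, fun w hw => ?_⟩
  · by_cases hw : m w ≤ 0 ∨ 1 ≤ m w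
    · simp only [hw, if_true]
      have hsum := T.measureReal_node G w
      rcases hw with hw | hw
      · have h0 : m w = 0 := le_antisymm hw (hm w).1
        have := hnull (false :: w) (by rw [(hP w).1, h0, mul_zero])
        rw [h0]
        constructor <;> linarith
      · have h1 : m w = 1 := le_antisymm (hm w).2 hw
        have := hnull (true :: w) (by rw [(hP w).2, h1, sub_self, mul_zero])
        rw [h1]
        constructor <;> linarith
    · simp only [hw, if_false]
      exact of_ratio G w
  · dsimp only
    split_ifs
    · exact hm w
    · exact ⟨by positivity, div_le_one_of_le₀ (measureReal_mono (T.node_cons_subset _ _))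
        measureReal_nonneg⟩
  · simp [hw]

/-- A random measure whose coefficients coincide with those of `P` from level `k` on, and whose
coefficients before level `k` are close to those of `G`, is close to `G` in `L¹`. -/
lemma integral_abs_rnDeriv_sub_le {μ : Measure Ω} [SigmaFinite μ] [IsProbabilityMeasure P]
    [IsProbabilityMeasure Q] [IsProbabilityMeasure G] (hPμ : P ≪ μ) (hGP : G ≪ P)
    (hP : HasPAC T P m) (hQ : HasPAC T Q θ) (hG : HasPAC T G a)
    (ha : ∀ w, 0 ≤ a w ∧ a w ≤ 1)
    (hdeg : ∀ w, w.length < k → (m w ≤ 0 ∨ 1 ≤ m w) → θ w = m w)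
    (hclose : ∀ w, w.length < k → |θ w - a w| ≤ η)
    (hfine : ∀ w, k ≤ w.length → θ w = m w) :
    Q ≪ μ ∧ ∫ x, |(Q.rnDeriv μ x).toReal - (G.rnDeriv μ x).toReal| ∂μ ≤
      (wordsOfLength k).card * (k * η) +
        ∫ x, |T.levelDensity P G k x - (G.rnDeriv P x).toReal| ∂P := by
  have h0 : ∀ w : List Bool, w.length = k → P.real (T.node w) = 0 → Q.real (T.node w) = 0 :=
    fun w hw => measureReal_eq_zero hP hQ hdeg w hw.le
  have hQeq := PartitionTree.withDensity_levelDensity_eq h0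
    fun u w hw => measureReal_append hP hQ hfine h0 u hw
  have hQP : Q ≪ P := hQeq ▸ withDensity_absolutelyContinuous _ _
  refine ⟨hQP.trans hPμ, ?_⟩
  rw [PartitionTree.integral_abs_rnDeriv_sub hPμ hQP hGP]
  have hrn : Q.rnDeriv P =ᵐ[P] fun x => ENNReal.ofReal (T.levelDensity P Q k x) := by
    have := Measure.rnDeriv_withDensity P
      (PartitionTree.measurable_levelDensity (T := T) (P := P) (R := Q) (k := k)).ennreal_ofReal
    rwa [hQeq] at this
  have hi1 : Integrable (fun x => |T.levelDensity P Q k x - T.levelDensity P G k x|) P :=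
    (PartitionTree.integrable_levelDensity.sub PartitionTree.integrable_levelDensity).abs
  have hi2 : Integrable (fun x => |T.levelDensity P G k x - (G.rnDeriv P x).toReal|) P :=
    (PartitionTree.integrable_levelDensity.sub Measure.integrable_toReal_rnDeriv).abs
  calc ∫ x, |(Q.rnDeriv P x).toReal - (G.rnDeriv P x).toReal| ∂P
      ≤ ∫ x, (|T.levelDensity P Q k x - T.levelDensity P G k x| +
          |T.levelDensity P G k x - (G.rnDeriv P x).toReal|) ∂P := by
        refine integral_mono_ae (Measure.integrable_toReal_rnDeriv.sub
          Measure.integrable_toReal_rnDeriv).abs (hi1.add hi2) ?_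
        filter_upwards [hrn] with x hx
        rw [hx, ENNReal.toReal_ofReal (PartitionTree.levelDensity_nonneg x)]
        exact abs_sub_le _ _ _
    _ = ∫ x, |T.levelDensity P Q k x - T.levelDensity P G k x| ∂P +
          ∫ x, |T.levelDensity P G k x - (G.rnDeriv P x).toReal| ∂P := integral_add hi1 hi2
    _ ≤ _ := by
        gcongr
        refine PartitionTree.integral_abs_levelDensity_sub_le.trans ?_
        rw [← nsmul_eq_mul]
        refine Finset.sum_le_card_nsmul _ _ _ fun w hw => ?_
        have hw' : w.length = k := mem_wordsOfLength.1 hw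
        simpa [hw'] using abs_measureReal_sub_le hQ hG ha hclose w hw'.le

end HasPAC

end

/-! ### The main theorem. -/

theorem mainTheorem2 {Ω : Type*} [MeasurableSpace Ω] (μ : Measure Ω) [SigmaFinite μ]
    (T : PartitionTree Ω) (K : ℕ) (p : MarkovAPTParams Ω K)
    (π : Measure (ProbabilityMeasure Ω)) (hπ : p.IsMarkovAPT T π)
    (hac : p.AbsContConditions)
    (hQ₀ : (p.Q₀ : Measure Ω) ≪ μ)
    (hI : 2 ≤ K + 1)
    (htrans : ∃ δ' : ℝ≥0∞, 0 < δ' ∧ ∀ᶠ k : ℕ in atTop, ∀ w : List Bool, w.length = k →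
      ∀ i : Fin (K + 1), i ≠ Fin.last K → p.trans w i (Fin.last K) < 1 - δ')
    (hinit : p.init (Fin.last K) < 1)
    (hcoarse : ∀ w : List Bool, w ≠ [] →
      ∀ i : Fin (K + 1), i ≠ Fin.last K → p.trans w i (Fin.last K) < 1)
    (hcomp : ∃ (ε : ℝ≥0∞) (N : ℝ≥0), 0 < ε ∧ 0 < N ∧
      ∀ i : Fin (K + 1), i ≠ Fin.last K → ∀ w : List Bool,
        ε < (p.comp w i : Measure ℝ≥0∞) (Set.Ioc 0 (N : ℝ≥0∞)))
    (G : ProbabilityMeasure Ω) (hG : (G : Measure Ω) ≪ (p.Q₀ : Measure Ω))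
    (τ : ℝ) (hτ : 0 < τ) :
    0 < π {Q : ProbabilityMeasure Ω | (Q : Measure Ω) ≪ μ ∧
      ∫ x, |((Q : Measure Ω).rnDeriv μ x).toReal - ((G : Measure Ω).rnDeriv μ x).toReal| ∂μ
        < τ} := by
  obtain ⟨J, hL, hPAC, rfl⟩ := hπ
  obtain ⟨hinc, hlast, δ, -, hδ⟩ := hac
  obtain ⟨ε, N, -, -, hN⟩ := hcomp
  have hconv := PartitionTree.tendsto_integral_abs_levelDensity_sub (T := T) hG
  -- `k ≥ 1` keeps the root out of the fine levels: δ bounds transitions only, and the initial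
  -- probability of complete shrinkage may be 0.
  obtain ⟨k, ⟨hk, hδk⟩, hk1⟩ := ((hconv.eventually_lt_const (half_pos hτ)).and hδ).and
    (eventually_ge_atTop 1) |>.exists
  have hP : HasPAC T (p.Q₀ : Measure Ω) (p.θ₀ T) := HasPAC.of_ratio _
  have hm : ∀ w, 0 ≤ p.θ₀ T w ∧ p.θ₀ T w ≤ 1 := fun w =>
    ⟨div_nonneg measureReal_nonneg measureReal_nonneg,
      div_le_one_of_le₀ (measureReal_mono (T.node_cons_subset _ _)) measureReal_nonneg⟩
  obtain ⟨a, hGa, ha, ham⟩ := HasPAC.exists_coefficients hP hm hG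
  set M : ℝ := (wordsOfLength k).card * k with hM
  have hM0 : 0 ≤ M := by positivity
  -- `M` bounds the total error per unit of η over the level-`k` nodes; adding 1 avoids a zero
  -- denominator.
  set η : ℝ := τ / 2 / (M + 1) with hηdef
  have hη : 0 < η := by positivity
  have hMη : M * η ≤ τ / 2 := by
    rw [hηdef, mul_div_assoc', div_le_iff₀ (by positivity)]
    nlinarith
  obtain ⟨c, hc, hc'⟩ := MarkovAPTParams.exists_states hinit hcoarse k
  classical
  let B : List Bool → Set ℝ≥0∞ := fun w => if w.length < k then Set.Ioc 0 (N : ℝ≥0∞) else Set.univ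
  let D : List Bool → Set ℝ := fun w =>
    if w.length < k ∧ ¬(p.θ₀ T w ≤ 0 ∨ 1 ≤ p.θ₀ T w) then Set.Ioo (a w - η) (a w + η)
    else {p.θ₀ T w}
  have hB : ∀ w, MeasurableSet (B w) := fun w => by
    dsimp only [B]; split_ifs <;> measurability
  have hD : ∀ w, MeasurableSet (D w) := fun w => by
    dsimp only [D]; split_ifs <;> measurability
  have hfine : ∀ w : List Bool, k ≤ w.length →
      ∫⁻ v in B w, betaLaw (p.θ₀ T w) v (D w) ∂(p.comp w (c w) : Measure ℝ≥0∞) = 1 := by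
    intro w hw
    have h1 : B w = Set.univ := if_neg hw.not_gt
    have h2 : D w = {p.θ₀ T w} := if_neg fun h => hw.not_gt h.1
    rw [h1, h2, Measure.restrict_univ, hc' w hw, hlast w, lintegral_dirac]
    simp [betaLaw]
  have hcoarse' : ∀ w : List Bool, w.length < k →
      ∫⁻ v in B w, betaLaw (p.θ₀ T w) v (D w) ∂(p.comp w (c w) : Measure ℝ≥0∞) ≠ 0 := by
    intro w hw
    have h1 : B w = Set.Ioc 0 (N : ℝ≥0∞) := if_pos hw
    rw [h1]
    refine (setLIntegral_betaLaw_pos (hD w) (zero_le.trans_lt (hN _ (hc w hw).1 w)).ne'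
      (fun h => ?_) fun h0 h1 => ?_).ne'
    · have h2 : D w = {p.θ₀ T w} := if_neg fun h' => h'.2 h
      rw [h2, Set.mem_singleton_iff]
    · have h2 : D w = Set.Ioo (a w - η) (a w + η) := if_pos ⟨hw, by simp [h0, h1]⟩
      -- The window around `a w` may leave [0,1]; its clipped part is nonempty because `a w` lies in
      -- [0,1].
      refine ⟨max 0 (a w - η), min 1 (a w + η), le_max_left _ _, min_le_left _ _, ?_, ?_⟩
      · have := ha w
        refine max_lt (lt_min ?_ ?_) (lt_min ?_ ?_) <;> linarith
      · rw [h2]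
        exact Set.Ioo_subset_Ioo (le_max_right _ _) (min_le_right _ _)
  -- `k + 1`, not `k`: a level-`k` node still has its parent outside complete shrinkage, so its
  -- factor is positive but need not be 1.
  have hpos := hL.measure_pos (c := c) hB hD (n := k + 1) (fun w => ?_) fun w hw => ?_
  rotate_left
  · rcases lt_or_ge w.length k with hw | hw
    · exact mul_ne_zero (hc w hw).2 (hcoarse' w hw)
    · rw [hfine w hw, mul_one]
      cases w with
      | nil => simp at hw; omega
      | cons b w =>
        simp only [MarkovAPTParams.stateFactor]
        rw [hc' _ hw]
        rcases lt_or_ge w.length k with hw' | hw'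
        · have hl : (b :: w).length = k := le_antisymm hw' hw
          exact (zero_le.trans_lt (hδk _ hl _ (hc w hw').1)).ne'
        · rw [hc' w hw', hinc.trans_last_last (List.cons_ne_nil _ _)]
          exact one_ne_zero
  · rw [hfine w (by omega), mul_one]
    cases w with
    | nil => simp at hw
    | cons b w =>
      have hw' : k ≤ w.length := by simpa using hw
      simp only [MarkovAPTParams.stateFactor]
      rw [hc' (b :: w) (hw'.trans (by simp)), hc' w hw', hinc.trans_last_last (List.cons_ne_nil _ _)]
  set E := {x : List Bool → Fin (K + 1) × ℝ≥0∞ × ℝ |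
    ∀ w, (x w).1 = c w ∧ (x w).2.1 ∈ B w ∧ (x w).2.2 ∈ D w} with hE
  have hEmeas : MeasurableSet E := by
    have : E = ⋂ w, (fun x : List Bool → Fin (K + 1) × ℝ≥0∞ × ℝ => x w) ⁻¹'
        ({c w} ×ˢ (B w ×ˢ D w)) := by
      ext x
      simp [hE, Set.mem_prod]
    rw [this]
    exact MeasurableSet.iInter fun w => measurable_pi_apply w
      ((measurableSet_singleton _).prod ((hB w).prod (hD w)))
  rw [Measure.map_apply measurable_fst hEmeas] at hpos
  -- The target set is not known to be measurable; the lower bound for the image measure holds for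
  -- every set.
  refine (hpos.trans_le (measure_mono_ae ?_)).trans_le
    (Measure.le_map_apply measurable_snd.aemeasurable _)
  filter_upwards [hPAC] with z hz hzE
  have hzD : ∀ w, (z.1 w).2.2 ∈ D w := fun w => (hzE w).2.2
  have hdeg : ∀ w, w.length < k → (p.θ₀ T w ≤ 0 ∨ 1 ≤ p.θ₀ T w) →
      (z.1 w).2.2 = p.θ₀ T w := fun w _ h => by
    have := hzD w
    rwa [show D w = {p.θ₀ T w} from if_neg fun h' => h'.2 h] at this
  have hclose : ∀ w, w.length < k → |(z.1 w).2.2 - a w| ≤ η := fun w hw => by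
    by_cases h : p.θ₀ T w ≤ 0 ∨ 1 ≤ p.θ₀ T w
    · rw [hdeg w hw h, ham w h, sub_self, abs_zero]
      exact hη.le
    · have := hzD w
      rw [show D w = Set.Ioo (a w - η) (a w + η) from if_pos ⟨hw, h⟩] at this
      rw [abs_le]
      constructor <;> linarith [this.1, this.2]
  have hlevel : ∀ w, k ≤ w.length → (z.1 w).2.2 = p.θ₀ T w := fun w hw => by
    have := hzD w
    rwa [show D w = {p.θ₀ T w} from if_neg fun h => hw.not_gt h.1] at this
  obtain ⟨h1, h2⟩ := HasPAC.integral_abs_rnDeriv_sub_le hQ₀ hG hP hz hGa ha hdeg hclose hlevel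
  refine ⟨h1, h2.trans_lt ?_⟩
  rw [← mul_assoc]
  linarith
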